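/- Let $\mathcal H$ be a real Hilbert space, let $N\ge 1$, and let $F_1,\dots,F_N:\mathcal H\to\mathcal H$ be nonexpansive, i.e. $\|F_i(x)-F_i(y)\|\le\|x-y\|$ for all $x,y\in\mathcal H$, with a nonempty set $X^*=\bigcap_{i=1}^N\{x\in\mathcal H:F_i(x)=x\}$ of common fixed points. For each $k\in\mathbb N=\{0,1,2,\dots\}$ let $\mathcal G_k=(\{1,\dots,N\},\mathcal E_k)$ be a digraph and $A_k=(a_{ij,k})\in\mathbb R^{N\times N}$ a matrix with $a_{ij,k}>0$ if $(j,i)\in\mathcal E_k$, $a_{ij,k}=0$ otherwise, and $a_{ii,k}>0$ for all $i$. Assume: (a) there is an integer $Q>0$ such that for every $k\ge0$ the union graph $\bigcup_{l=1}^{Q}\mathcal G_{k+l}$ is strongly connected (there is a directed path from every node to every other node); (b) $\sum_{j=1}^N a_{ij,k}=1$ for all $i$ and $k$, and there is a constant $\underline a\in(0,1)$ such that, for all $i,j,k$, $a_{ij,k}>\underline a$ whenever $a_{ij,k}>0$. Let $\alpha_{i,k}\in[\alpha,1-\alpha]$ for all $i,k$, for some constant $\alpha\in(0,1/2]$, and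 let $\epsilon_{i,k}\in\mathcal H$ satisfy $\sum_{k=0}^\infty\|\epsilon_{i,k}\|<\infty$ for every $i$. Starting from arbitrary $x_{1,0},\dots,x_{N,0}\in\mathcal H$, let the sequences $(x_{i,k})_{k\in\mathbb N}$ be generated by the distributed inexact Krasnosel'skiĭ–Mann iteration $$x_{i,k+1}=\hat x_{i,k}+\alpha_{i,k}\bigl(F_i(\hat x_{i,k})+\epsilon_{i,k}-\hat x_{i,k}\bigr),\qquad \hat x_{i,k}=\sum_{j=1}^N a_{ij,k}x_{j,k},\qquad i=1,\dots,N.$$ Then: 1. the sequences $(x_{i,k})_{k\in\mathbb N}$, $i=1,\dots,N$, are bounded, and there is a point $x'\in X^*$ such that, for every $i$, $x_{i,k}$ converges weakly to $x'$ as $k\to\infty$; 2. there is a strictly increasing sequence $(k_l)_{l\ge1}$ in $\mathbb N$, the same for all $i$, such that for every $i$ $$\|F_i(x_{i,k_l})-x_{i,k_l}\|=O\!\left(\frac1{\sqrt{k_l}}\right)\quad\text{as } l\to\infty.$$ -/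

import Mathlib

open Filter Topology Asymptotics

namespace DIKM

/-- A digraph is strongly connected if there is a directed path from every node to every
other node. -/
def StronglyConnected {V : Type*} (G : Digraph V) : Prop :=
  ∀ i j : V, i ≠ j → Relation.TransGen G.Adj i j

/-- The time-varying digraphs `G k` are uniformly jointly strongly connected: for some `Q > 0`,
each union `G (k + 1) ∪ ⋯ ∪ G (k + Q)` is strongly connected. -/
def UniformlyJointlyStronglyConnected {V : Type*} (G : ℕ → Digraph V) : Prop :=
  ∃ Q : ℕ, 0 < Q ∧ ∀ k : ℕ, StronglyConnected (⨆ l ∈ Finset.Icc 1 Q, G (k + l))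

/-- `A` is an adjacency (weight) matrix of `G`: `A i j` is positive when `(j, i)` is an edge,
that is, when `j` can send to `i`, and is zero otherwise; the diagonal entries are positive. -/
structure IsWeightMatrix {N : ℕ} (G : Digraph (Fin N)) (A : Matrix (Fin N) (Fin N) ℝ) :
    Prop where
  pos_of_edge : ∀ i j, G.Adj j i → 0 < A i j
  zero_of_not_edge : ∀ i j, ¬ G.Adj j i → A i j = 0
  diag_pos : ∀ i, 0 < A i i

/-- The connectivity and weights rule: uniform joint strong connectivity, row-stochasticity, and
a uniform lower bound in `(0, 1)` on the positive weights. -/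
structure ConnectivityAndWeightsRule {N : ℕ} (G : ℕ → Digraph (Fin N))
    (A : ℕ → Matrix (Fin N) (Fin N) ℝ) : Prop where
  connected : UniformlyJointlyStronglyConnected G
  row_sum : ∀ k i, ∑ j, A k i j = 1
  lower_bound : ∃ a : ℝ, 0 < a ∧ a < 1 ∧ ∀ k i j, 0 < A k i j → a < A k i j

variable {H : Type*} [NormedAddCommGroup H] [InnerProductSpace ℝ H]

/-- A nonexpansive operator on `H`. -/
def Nonexpansive (T : H → H) : Prop :=
  ∀ x y, ‖T x - T y‖ ≤ ‖x - y‖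

/-- The aggregate `x̂ i = ∑ j, a i j • x j` of the information that agent `i` receives. -/
noncomputable def aggregate {N : ℕ} (A : Matrix (Fin N) (Fin N) ℝ) (x : Fin N → H)
    (i : Fin N) : H :=
  ∑ j, A i j • x j

/-- `x` is generated by the distributed inexact Krasnosel'skii-Mann iteration with operators `F`,
weights `A`, relaxation parameters `α` and errors `ε` (from an arbitrary initial point). -/
def IsIteration {N : ℕ} (F : Fin N → H → H) (A : ℕ → Matrix (Fin N) (Fin N) ℝ)
    (α : Fin N → ℕ → ℝ) (ε x : Fin N → ℕ → H) : Prop :=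
  ∀ i k, x i (k + 1) = aggregate (A k) (fun j => x j k) i +
    α i k • (F i (aggregate (A k) (fun j => x j k) i) + ε i k
      - aggregate (A k) (fun j => x j k) i)

/-- The common fixed points of the operators `F i`. -/
def commonFixedPoints {N : ℕ} (F : Fin N → H → H) : Set H :=
  ⋂ i, Function.fixedPoints (F i)

end DIKM

/-! For a common fixed point `p`, neither averaging nor a relaxed nonexpansive step increases `max_i
‖x i k - p‖`, so this maximum decreases up to summable errors. This gives boundedness and
convergence of the maximum, but does not show where strict decrease occurs.

The strict decrease comes from the weighted energy `∑ i, w k i * ‖x i k - p‖ ^ 2`, where `w` solves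
the adjoint recursion backward from a finite horizon. Each step loses a multiple of the disagreement
inside the averages plus the fixed point residuals. Joint connectivity keeps `w` above a constant
independent of the horizon (`backward_weights_lower_bound`), so these losses are summable
(`IsIteration.exists_residual_bound`).

Connectivity over windows of length `Q` then makes all disagreements square summable
(`exists_disagreement_bound`). Demiclosedness and Opial's lemma, applied to one agent, give the
common weak limit. The rate follows because one square summable bound serves all residuals. -/

namespace DIKM

/-! ### Propagation along strongly connected digraphs -/

section Connectivity

lemma StronglyConnected.exists_adj_mem_notMem {V : Type*} {G : Digraph V}
    (hG : StronglyConnected G) {S : Set V} {i j : V} (hi : i ∈ S) (hj : j ∉ S) :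
    ∃ u ∈ S, ∃ v, v ∉ S ∧ G.Adj u v := by
  by_contra! h
  have hij : i ≠ j := fun e => hj (e ▸ hi)
  have key : ∀ v, Relation.TransGen G.Adj i v → v ∈ S := by
    intro v hv
    induction hv with
    | single h1 => by_contra hv; exact h _ hi _ hv h1
    | tail _ h1 ih => by_contra hv; exact h _ ih _ hv h1
  exact hj (key j (hG i j hij))

/-- A property that holds at one node and spreads along the edges of a sequence of strongly
connected digraphs on `N` nodes holds everywhere after `N` steps. -/
lemma spread_of_stronglyConnected {N : ℕ} {G : ℕ → Digraph (Fin N)}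
    (hG : ∀ n, StronglyConnected (G n)) {P : ℕ → Fin N → Prop} {i : Fin N} (h0 : P 0 i)
    (hmono : ∀ n u, P n u → P (n + 1) u)
    (hadj : ∀ n u v, P n u → (G n).Adj u v → P (n + 1) v) (v : Fin N) : P N v := by
  classical
  let S : ℕ → Finset (Fin N) := fun n => Finset.univ.filter (P n)
  -- Until `P` holds everywhere, some edge leaves the set where it holds, so that set gains a node
  -- at each step; it cannot exceed `N` nodes.
  have hS : ∀ n, (∀ v, P n v) ∨ n < (S n).card := by
    intro n
    induction n with
    | zero => exact Or.inr (Finset.card_pos.2 ⟨i, by simpa [S] using h0⟩)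
    | succ n ih =>
      rcases ih with h | h
      · exact Or.inl fun v => hmono n v (h v)
      · by_cases hall : ∀ v, P n v
        · exact Or.inl fun v => hmono n v (hall v)
        · push Not at hall
          obtain ⟨w, hw⟩ := hall
          obtain ⟨u, hu⟩ : (S n).Nonempty := Finset.card_pos.1 (by omega)
          have hu' : P n u := by simpa [S] using hu
          obtain ⟨u', hu', v', hv', huv⟩ :=
            (hG n).exists_adj_mem_notMem (S := {v | P n v}) hu' hw
          right
          have hlt : S n ⊂ S (n + 1) := by
            rw [Finset.ssubset_iff_of_subset]
            · exact ⟨v', by simpa [S] using hadj n _ _ hu' huv, by simpa [S] using hv'⟩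
            · intro z hz
              simp only [S, Finset.mem_filter, Finset.mem_univ, true_and] at hz ⊢
              exact hmono n z hz
          have := Finset.card_lt_card hlt
          omega
  rcases hS N with h | h
  · exact h v
  · have := Finset.card_le_univ (S N)
    simp at this
    omega

lemma norm_sub_le_of_stronglyConnected {E : Type*} [SeminormedAddCommGroup E] {N : ℕ}
    {G : Digraph (Fin N)} (hG : StronglyConnected G) {f : Fin N → E} {b : ℝ} (hb : 0 ≤ b)
    (h : ∀ u v, G.Adj u v → ‖f v - f u‖ ≤ b) (i j : Fin N) : ‖f i - f j‖ ≤ N * b := by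
  refine spread_of_stronglyConnected (G := fun _ => G) (P := fun n u => ‖f u - f j‖ ≤ n * b)
    (i := j) (fun _ => hG) (by simp) ?_ ?_ i
  · intro n u hu
    push_cast
    linarith
  · intro n u v hu huv
    have := norm_sub_le_norm_sub_add_norm_sub (f v) (f u) (f j)
    have := h u v huv
    push_cast
    linarith

end Connectivity

/-! ### Adjoint weights for products of row-stochastic matrices -/

section Weights

/-- The backward weights `w k = (A k)ᵀ w (k + 1)`, started from the uniform distribution. -/
lemma exists_backward_weights {N : ℕ} (hN : 0 < N) (m : ℕ) (A : ℕ → Matrix (Fin N) (Fin N) ℝ)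
    (hnn : ∀ k i j, 0 ≤ A k i j) (hsum : ∀ k i, ∑ j, A k i j = 1) :
    ∃ w : ℕ → Fin N → ℝ, (∀ k i, 0 ≤ w k i) ∧ (∀ k, ∑ i, w k i = 1) ∧
      ∀ k < m, ∀ j, w k j = ∑ i, w (k + 1) i * A k i j := by
  induction m generalizing A with
  | zero =>
    refine ⟨fun _ _ => 1 / N, fun _ _ => by positivity, fun _ => ?_, by simp⟩
    have : (N : ℝ) ≠ 0 := by positivity
    simp [this]
  | succ m ih =>
    obtain ⟨w, h1, h2, h3⟩ := ih (fun k => A (k + 1)) (fun k => hnn _) (fun k => hsum _)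
    -- The induction removes the earliest matrix: solve for the shifted sequence, then prepend one
    -- adjoint step.
    refine ⟨fun k => Nat.casesOn k (fun j => ∑ i, w 0 i * A 0 i j) w, ?_, ?_, ?_⟩
    · rintro (_ | k) i
      · exact Finset.sum_nonneg fun j _ => mul_nonneg (h1 _ _) (hnn _ _ _)
      · exact h1 k i
    · rintro (_ | k)
      · change ∑ j, ∑ i, w 0 i * A 0 i j = 1
        rw [Finset.sum_comm]
        simp [← Finset.mul_sum, hsum, h2]
      · exact h2 k
    · rintro (_ | k) hk j
      · rfl
      · exact h3 k (by omega) j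

/-- Backward weights are bounded below at a positive distance from the horizon. -/
lemma backward_weights_lower_bound {N : ℕ} {G : ℕ → Digraph (Fin N)}
    {A : ℕ → Matrix (Fin N) (Fin N) ℝ} {Q : ℕ}
    (hG : ∀ k, StronglyConnected (⨆ l ∈ Finset.Icc 1 Q, G (k + l)))
    (hnn : ∀ k i j, 0 ≤ A k i j) {a : ℝ} (ha : 0 < a)
    (hdiag : ∀ k i, a ≤ A k i i) (hadj : ∀ k i j, (G k).Adj j i → a ≤ A k i j)
    {m : ℕ} {w : ℕ → Fin N → ℝ} (hw0 : ∀ k i, 0 ≤ w k i) (hw1 : ∀ k, ∑ i, w k i = 1)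
    (hw : ∀ k < m, ∀ j, w k j = ∑ i, w (k + 1) i * A k i j)
    {k : ℕ} (hk : k + 1 + N * Q ≤ m) (j : Fin N) : a ^ (N * Q) / N ≤ w (k + 1) j := by
  have hstep : ∀ k < m, ∀ i j, a ≤ A k i j → a * w (k + 1) i ≤ w k j := by
    intro k hk i j h
    rw [hw k hk j]
    calc a * w (k + 1) i ≤ w (k + 1) i * A k i j := by
          rw [mul_comm]; exact mul_le_mul_of_nonneg_left h (hw0 _ _)
      _ ≤ _ := Finset.single_le_sum (f := fun i => w (k + 1) i * A k i j)
          (fun i _ => mul_nonneg (hw0 _ _) (hnn _ _ _)) (Finset.mem_univ i)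
  have hself : ∀ n k, k + n ≤ m → ∀ i, a ^ n * w (k + n) i ≤ w k i := by
    intro n
    induction n with
    | zero => intro k _ i; simp
    | succ n ih =>
      intro k hk i
      have h1 := ih k (by omega) i
      have h2 := hstep (k + n) (by omega) i i (hdiag _ _)
      have h3 := mul_le_mul_of_nonneg_left h2 (pow_nonneg ha.le n)
      rw [show k + (n + 1) = k + n + 1 by ring, pow_succ, mul_assoc]
      linarith
  -- The property spread, one window per step, is that a node's later weight flows back to `j` at
  -- the cost of a factor `a` per unit of time. The premise keeps times within the horizon; it is
  -- trivial here only to match the case `n = N`.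
  have hspread : ∀ i, N * Q ≤ N * Q → a ^ (N * Q) * w (k + 1 + N * Q) i ≤ w (k + 1) j := by
    refine spread_of_stronglyConnected
      (G := fun n => ⨆ l ∈ Finset.Icc 1 Q, G (k + n * Q + l))
      (P := fun n i => n * Q ≤ N * Q → a ^ (n * Q) * w (k + 1 + n * Q) i ≤ w (k + 1) j)
      (i := j) (fun n => hG _) (by simp) ?_ ?_
    · intro n u hu hn
      have hnQ : (n + 1) * Q = n * Q + Q := by ring
      have h1 := hu (by omega)
      have h2 := hself Q (k + 1 + n * Q) (by omega) u
      have h3 := mul_le_mul_of_nonneg_left h2 (pow_nonneg ha.le (n * Q))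
      rw [hnQ, pow_add, ← add_assoc, mul_assoc]
      linarith
    · intro n u v hu huv hn
      have hnQ : (n + 1) * Q = n * Q + Q := by ring
      have h1 := hu (by omega)
      simp only [Digraph.iSup_adj, Finset.mem_Icc, exists_prop] at huv
      obtain ⟨l, ⟨hl1, hlQ⟩, huv⟩ := huv
      -- Split the window: stay at `u` until the edge is available, cross to `v`, and stay there for
      -- the remaining `r` steps. Staying uses the diagonal weights.
      obtain ⟨l, rfl⟩ : ∃ l', l = l' + 1 := ⟨l - 1, by omega⟩
      obtain ⟨r, rfl⟩ : ∃ r, Q = l + 1 + r := ⟨Q - (l + 1), by omega⟩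
      set q := l + 1 + r with hq
      have e1 : k + n * q + (l + 1) = k + 1 + n * q + l := by ring
      rw [e1] at huv
      have h2 := hself l (k + 1 + n * q) (by omega) u
      have h3 := hstep (k + 1 + n * q + l) (by omega) v u (hadj _ _ _ huv)
      have h4 := hself r (k + 1 + n * q + l + 1) (by omega) v
      rw [show k + 1 + n * q + l + 1 + r = k + 1 + (n + 1) * q by rw [hnQ]; omega] at h4
      have hp : a ^ q * w (k + 1 + (n + 1) * q) v ≤ w (k + 1 + n * q) u := by
        calc a ^ q * w (k + 1 + (n + 1) * q) v
            = a ^ l * (a * (a ^ r * w (k + 1 + (n + 1) * q) v)) := by rw [hq]; ring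
          _ ≤ a ^ l * (a * w (k + 1 + n * q + l + 1) v) := by gcongr
          _ ≤ a ^ l * w (k + 1 + n * q + l) u := by gcongr
          _ ≤ _ := h2
      calc a ^ ((n + 1) * q) * w (k + 1 + (n + 1) * q) v
          = a ^ (n * q) * (a ^ q * w (k + 1 + (n + 1) * q) v) := by
            rw [hnQ, pow_add]; ring
        _ ≤ a ^ (n * q) * w (k + 1 + n * q) u := by gcongr
        _ ≤ _ := h1
  have hNpos : (0 : ℝ) < N := by exact_mod_cast Fin.pos j
  rw [div_le_iff₀ hNpos]
  -- Summing over `i` uses that the later weights have total mass one.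
  calc a ^ (N * Q) = ∑ i, a ^ (N * Q) * w (k + 1 + N * Q) i := by
        rw [← Finset.mul_sum, hw1, mul_one]
    _ ≤ ∑ _i : Fin N, w (k + 1) j := Finset.sum_le_sum fun i _ => hspread i le_rfl
    _ = w (k + 1) j * N := by simp [mul_comm]

end Weights

/-! ### Summability and almost monotone real sequences -/

section RealSequences

lemma summable_sq_of_summable {f : ℕ → ℝ} (hf0 : ∀ k, 0 ≤ f k) (hf : Summable f) :
    Summable fun k => f k ^ 2 := by
  refine Summable.of_nonneg_of_le (fun k => sq_nonneg _) (fun k => ?_) (hf.mul_left (∑' k, f k))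
  rw [sq]
  exact mul_le_mul_of_nonneg_right (hf.le_tsum k fun j _ => hf0 j) (hf0 k)

lemma summable_sq_add {f g : ℕ → ℝ} (hf : Summable fun k => f k ^ 2)
    (hg : Summable fun k => g k ^ 2) : Summable fun k => (f k + g k) ^ 2 := by
  refine Summable.of_nonneg_of_le (fun k => sq_nonneg _) (fun k => ?_)
    ((hf.mul_left 2).add (hg.mul_left 2))
  nlinarith [sq_nonneg (f k - g k)]

lemma summable_sq_const_mul {f : ℕ → ℝ} (c : ℝ) (hf : Summable fun k => f k ^ 2) :
    Summable fun k => (c * f k) ^ 2 := by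
  simpa only [mul_pow] using hf.mul_left (c ^ 2)

lemma summable_sq_sum_range_shift {f : ℕ → ℝ} (hf : Summable fun k => f k ^ 2) (n : ℕ) :
    Summable fun k => (∑ l ∈ Finset.range n, f (k + l)) ^ 2 := by
  induction n with
  | zero => simp
  | succ n ih =>
    simp only [Finset.sum_range_succ]
    exact summable_sq_add ih ((summable_nat_add_iff (f := fun k => f k ^ 2) n).2 hf)

lemma tendsto_zero_of_summable_sq {f : ℕ → ℝ} (hf : Summable fun k => f k ^ 2) :
    Tendsto f atTop (𝓝 0) := by
  have h := hf.tendsto_atTop_zero.sqrt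
  simp only [Real.sqrt_sq_eq_abs, Real.sqrt_zero] at h
  exact (tendsto_zero_iff_abs_tendsto_zero _).2 h

/-- A nonnegative sequence that decreases up to summable errors converges. -/
lemma exists_tendsto_of_le_add_summable {M e : ℕ → ℝ} (hM : ∀ k, 0 ≤ M k) (he : ∀ k, 0 ≤ e k)
    (hes : Summable e) (h : ∀ k, M (k + 1) ≤ M k + e k) : ∃ l, Tendsto M atTop (𝓝 l) := by
  have hanti : Antitone fun k => M k - ∑ j ∈ Finset.range k, e j := by
    refine antitone_nat_of_succ_le fun k => ?_
    rw [Finset.sum_range_succ]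
    linarith [h k]
  have hbdd : BddBelow (Set.range fun k => M k - ∑ j ∈ Finset.range k, e j) := by
    refine ⟨-∑' j, e j, ?_⟩
    rintro _ ⟨k, rfl⟩
    have := hes.sum_le_tsum (Finset.range k) fun j _ => he j
    simp only
    linarith [hM k]
  have := (tendsto_atTop_ciInf hanti hbdd).add hes.hasSum.tendsto_sum_nat
  exact ⟨_, by simpa using this⟩

lemma le_add_tsum_of_le_add {M e : ℕ → ℝ} (he : ∀ k, 0 ≤ e k)
    (hes : Summable e) (h : ∀ k, M (k + 1) ≤ M k + e k) (k : ℕ) : M k ≤ M 0 + ∑' j, e j := by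
  have h1 : M k ≤ M 0 + ∑ j ∈ Finset.range k, e j := by
    induction k with
    | zero => simp
    | succ k ih => rw [Finset.sum_range_succ]; linarith [h k]
  linarith [hes.sum_le_tsum (Finset.range k) fun j _ => he j]

/-- A square summable sequence is below `1 / √k` along a subsequence. -/
lemma exists_strictMono_le_one_div_sqrt {f : ℕ → ℝ} (hf : Summable fun k => f k ^ 2) :
    ∃ φ : ℕ → ℕ, StrictMono φ ∧ ∀ l, f (φ l) ≤ 1 / √(φ l : ℝ) := by
  refine extraction_of_frequently_atTop (P := fun k : ℕ => f k ≤ 1 / √(k : ℝ)) ?_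
  -- Otherwise `f k ^ 2` eventually dominates `1 / k`, and the harmonic series would converge.
  intro h
  refine Real.not_summable_one_div_natCast ?_
  refine Summable.of_norm_bounded_eventually_nat hf ?_
  filter_upwards [h] with k hk
  have h0 : 0 ≤ 1 / √(k : ℝ) := by positivity
  have hk' := pow_le_pow_left₀ h0 (not_le.1 hk).le 2
  rw [div_pow, one_pow, Real.sq_sqrt (Nat.cast_nonneg k)] at hk'
  rwa [Real.norm_of_nonneg (by positivity)]

end RealSequences

/-! ### Averages, relaxed nonexpansive steps and weak limits -/

section Hilbert

variable {H : Type*} [NormedAddCommGroup H] [InnerProductSpace ℝ H]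

/-- Bias-variance decomposition: deviations from the mean average to zero, which kills the cross
term. The variance will measure the disagreement. -/
lemma sum_mul_norm_sub_sq {N : ℕ} {c : Fin N → ℝ} (hc : ∑ j, c j = 1) (x : Fin N → H) (p : H) :
    ∑ j, c j * ‖x j - p‖ ^ 2 =
      ‖∑ j, c j • x j - p‖ ^ 2 + ∑ j, c j * ‖x j - ∑ j, c j • x j‖ ^ 2 := by
  set y := ∑ j, c j • x j with hy
  have h0 : ∑ j, c j * inner ℝ (x j - y) (y - p) = 0 := by
    have : ∑ j, c j • (x j - y) = 0 := by
      simp [smul_sub, Finset.sum_sub_distrib, ← Finset.sum_smul, hc, ← hy]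
    simp_rw [← real_inner_smul_left]
    rw [← sum_inner, this, inner_zero_left]
  have h1 : ∀ j, c j * ‖x j - p‖ ^ 2 = c j * ‖x j - y‖ ^ 2 +
      2 * (c j * inner ℝ (x j - y) (y - p)) + c j * ‖y - p‖ ^ 2 := by
    intro j
    rw [← sub_add_sub_cancel (x j) y p, norm_add_sq_real]
    ring
  simp_rw [h1, Finset.sum_add_distrib, ← Finset.mul_sum, ← Finset.sum_mul, h0, hc]
  ring

/-- Nonexpansiveness at `p` says `2⟪y - p, T y - y⟫ ≤ -‖T y - y‖ ^ 2`, which controls the cross term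
of the expanded square. -/
lemma Nonexpansive.norm_relaxation_sub_sq_le {T : H → H} (hT : Nonexpansive T) {p : H}
    (hp : T p = p) {t : ℝ} (ht : 0 ≤ t) (y : H) :
    ‖y + t • (T y - y) - p‖ ^ 2 ≤ ‖y - p‖ ^ 2 - t * (1 - t) * ‖T y - y‖ ^ 2 := by
  have h1 : ‖T y - p‖ ^ 2 ≤ ‖y - p‖ ^ 2 := by
    have := hT y p
    rw [hp] at this
    gcongr
  rw [show T y - p = (y - p) + (T y - y) by abel, norm_add_sq_real] at h1
  rw [show y + t • (T y - y) - p = (y - p) + t • (T y - y) by abel, norm_add_sq_real,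
    real_inner_smul_right, norm_smul, mul_pow, Real.norm_eq_abs, sq_abs]
  nlinarith

lemma tendsto_inner_of_norm_sub_le {ι : Type*} {l : Filter ι} {u u' : ι → H} {d : ι → ℝ}
    (hd : Tendsto d l (𝓝 0)) (h : ∀ k, ‖u k - u' k‖ ≤ d k) {c : ℝ} {v : H}
    (hu' : Tendsto (fun k => inner ℝ (u' k) v) l (𝓝 c)) :
    Tendsto (fun k => inner ℝ (u k) v) l (𝓝 c) := by
  have h1 : Tendsto (fun k => u k - u' k) l (𝓝 0) := squeeze_zero_norm h hd
  have h2 := h1.inner (tendsto_const_nhds (x := v)) (𝕜 := ℝ)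
  simpa [inner_sub_left] using hu'.add h2

/-- Demiclosedness of `T - id` at zero for a nonexpansive operator `T`. -/
lemma Nonexpansive.isFixedPt_of_tendsto {T : H → H} (hT : Nonexpansive T) {ι : Type*}
    {l : Filter ι} [l.NeBot] {u : ι → H} {w : H} {C : ℝ} (hu : ∀ k, ‖u k‖ ≤ C)
    (hw : ∀ v, Tendsto (fun k => inner ℝ (u k) v) l (𝓝 (inner ℝ w v)))
    (hr : Tendsto (fun k => ‖T (u k) - u k‖) l (𝓝 0)) : T w = w := by
  -- Expanding `‖u k - T w‖ ^ 2` around `w` lets `‖u k - w‖ ^ 2` cancel; all that remains on the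
  -- right tends to zero.
  have key : ∀ k, ‖w - T w‖ ^ 2 ≤ ‖T (u k) - u k‖ ^ 2 + 2 * ‖T (u k) - u k‖ * (C + ‖w‖)
      - 2 * (inner ℝ (u k) (w - T w) - inner ℝ w (w - T w)) := by
    intro k
    have h1 : ‖u k - T w‖ ≤ ‖T (u k) - u k‖ + ‖u k - w‖ := by
      have h2 := norm_sub_le_norm_sub_add_norm_sub (u k) (T (u k)) (T w)
      rw [norm_sub_rev (u k) (T (u k))] at h2
      linarith [hT (u k) w]
    have h3 : ‖u k - T w‖ ^ 2 ≤ (‖T (u k) - u k‖ + ‖u k - w‖) ^ 2 := by gcongr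
    rw [← sub_add_sub_cancel (u k) w (T w), norm_add_sq_real, inner_sub_left] at h3
    have h4 : ‖u k - w‖ ≤ C + ‖w‖ := (norm_sub_le _ _).trans (by linarith [hu k])
    have h5 := mul_le_mul_of_nonneg_left h4 (norm_nonneg (T (u k) - u k))
    nlinarith
  have hlim : Tendsto (fun k => ‖T (u k) - u k‖ ^ 2 + 2 * ‖T (u k) - u k‖ * (C + ‖w‖)
      - 2 * (inner ℝ (u k) (w - T w) - inner ℝ w (w - T w))) l (𝓝 (0 ^ 2 + 2 * 0 * (C + ‖w‖)
      - 2 * (inner ℝ w (w - T w) - inner ℝ w (w - T w)))) :=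
    ((hr.pow 2).add ((hr.const_mul 2).mul_const _)).sub (((hw _).sub_const _).const_mul 2)
  have h := ge_of_tendsto' hlim key
  have h0 : ‖w - T w‖ ^ 2 ≤ 0 := by simpa using h
  have h1 : ‖w - T w‖ = 0 := by nlinarith [norm_nonneg (w - T w)]
  exact (sub_eq_zero.1 (norm_eq_zero.1 h1)).symm

variable [CompleteSpace H]

/-- Along an ultrafilter every bounded scalar family converges; the limits are linear and bounded in
`v`, so the Riesz theorem supplies `w`. -/
lemma exists_weak_limit_of_bounded {ι : Type*} (U : Ultrafilter ι) {u : ι → H} {C : ℝ}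
    (hu : ∀ k, ‖u k‖ ≤ C) :
    ∃ w, ∀ v, Tendsto (fun k => inner ℝ (u k) v) U (𝓝 (inner ℝ w v)) := by
  have hlim : ∀ v, ∃ c : ℝ, |c| ≤ C * ‖v‖ ∧ Tendsto (fun k => inner ℝ (u k) v) U (𝓝 c) := by
    intro v
    have hk : ∀ k, inner ℝ (u k) v ∈ Metric.closedBall (0 : ℝ) (C * ‖v‖) := by
      intro k
      rw [mem_closedBall_zero_iff]
      exact (norm_inner_le_norm _ _).trans (by gcongr; exact hu k)
    obtain ⟨c, hc, hUc⟩ := (isCompact_closedBall (0 : ℝ) (C * ‖v‖)).ultrafilter_le_nhds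
      (U.map fun k => inner ℝ (u k) v)
      (le_principal_iff.2 (Filter.mem_map.2 (Eventually.of_forall hk)))
    exact ⟨c, by simpa using hc, hUc⟩
  choose f hfC hf using hlim
  let g : H →ₗ[ℝ] ℝ :=
    { toFun := f
      map_add' := fun v v' => tendsto_nhds_unique (hf (v + v'))
        (by simpa only [inner_add_right] using (hf v).add (hf v'))
      map_smul' := fun c v => tendsto_nhds_unique (hf (c • v))
        (by simpa only [real_inner_smul_right, smul_eq_mul, RingHom.id_apply] using
          (hf v).const_mul c) }
  refine ⟨(InnerProductSpace.toDual ℝ H).symm (g.mkContinuous C hfC), fun v => ?_⟩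
  rw [InnerProductSpace.toDual_symm_apply]
  exact hf v

/-- Opial's lemma. -/
lemma exists_weak_limit_of_opial {S : Set H} {u : ℕ → H} {C : ℝ} (hu : ∀ k, ‖u k‖ ≤ C)
    (hS : ∀ p ∈ S, ∃ l, Tendsto (fun k => ‖u k - p‖) atTop (𝓝 l))
    (hcl : ∀ (U : Ultrafilter ℕ) (w : H), (U : Filter ℕ) ≤ atTop →
      (∀ v, Tendsto (fun k => inner ℝ (u k) v) U (𝓝 (inner ℝ w v))) → w ∈ S) :
    ∃ p ∈ S, ∀ v, Tendsto (fun k => inner ℝ (u k) v) atTop (𝓝 (inner ℝ p v)) := by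
  have hle := Ultrafilter.of_le (atTop : Filter ℕ)
  obtain ⟨p, hp⟩ := exists_weak_limit_of_bounded (Ultrafilter.of atTop) hu
  have hpS := hcl _ p hle hp
  refine ⟨p, hpS, fun v => tendsto_iff_ultrafilter _ _ _ |>.2 fun U hU => ?_⟩
  obtain ⟨q, hq⟩ := exists_weak_limit_of_bounded U hu
  have hqS := hcl U q hU hq
  suffices h : q = p by
    have := hq v
    rwa [h] at this
  obtain ⟨a, ha⟩ := hS p hpS
  obtain ⟨b, hb⟩ := hS q hqS
  -- This inner product is an affine function of `‖u k - p‖ ^ 2 - ‖u k - q‖ ^ 2`, so it converges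
  -- along the whole sequence; its limits `⟪p, q - p⟫` and `⟪q, q - p⟫` along the two ultrafilters
  -- must agree.
  have hconv : Tendsto (fun k => inner ℝ (u k) (q - p)) atTop
      (𝓝 ((a ^ 2 - b ^ 2 - (‖p‖ ^ 2 - ‖q‖ ^ 2)) / 2)) := by
    refine ((((ha.pow 2).sub (hb.pow 2)).sub_const _).div_const 2).congr fun k => ?_
    rw [norm_sub_sq_real, norm_sub_sq_real, inner_sub_right]
    ring
  have h1 := tendsto_nhds_unique (hp (q - p)) (hconv.mono_left hle)
  have h2 := tendsto_nhds_unique (hq (q - p)) (hconv.mono_left hU)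
  have h3 : inner ℝ (q - p) (q - p) = 0 := by rw [inner_sub_left, h1, h2, sub_self]
  exact sub_eq_zero.1 (inner_self_eq_zero.1 h3)

lemma tendsto_toWeakSpace_of_tendsto_inner {ι : Type*} {l : Filter ι} {u : ι → H} {p : H}
    (h : ∀ v, Tendsto (fun k => inner ℝ (u k) v) l (𝓝 (inner ℝ p v))) :
    Tendsto (fun k => toWeakSpace ℝ H (u k)) l (𝓝 (toWeakSpace ℝ H p)) := by
  refine (WeakBilin.tendsto_iff_forall_eval_tendsto (topDualPairing ℝ H).flip ?_).2 fun f => ?_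
  · exact fun x y hxy => by
      refine ext_inner_right ℝ fun v => ?_
      have := DFunLike.congr_fun hxy (InnerProductSpace.toDual ℝ H v)
      simpa [real_inner_comm] using this
  · have := h ((InnerProductSpace.toDual ℝ H).symm f)
    have he : ∀ z, inner ℝ z ((InnerProductSpace.toDual ℝ H).symm f) = f z := fun z => by
      rw [real_inner_comm, InnerProductSpace.toDual_symm_apply]
    simp only [he] at this
    exact this

end Hilbert

/-! ### Energy estimates and consensus for the iteration -/

section Iteration

variable {H : Type*} [NormedAddCommGroup H] [InnerProductSpace ℝ H] {N : ℕ}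

/-- The norm on `Fin N → H` is the maximum over agents, which no convex combination exceeds. -/
lemma norm_aggregate_sub_le {A : Matrix (Fin N) (Fin N) ℝ} (hnn : ∀ i j, 0 ≤ A i j)
    (hsum : ∀ i, ∑ j, A i j = 1) (x : Fin N → H) (p : H) (i : Fin N) :
    ‖aggregate A x i - p‖ ≤ ‖fun j => x j - p‖ := by
  have h : aggregate A x i - p = ∑ j, A i j • (x j - p) := by
    simp [aggregate, smul_sub, Finset.sum_sub_distrib, ← Finset.sum_smul, hsum]
  rw [h]
  calc ‖∑ j, A i j • (x j - p)‖ ≤ ∑ j, A i j * ‖fun j => x j - p‖ := by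
        refine norm_sum_le_of_le _ fun j _ => ?_
        rw [norm_smul, Real.norm_of_nonneg (hnn i j)]
        exact mul_le_mul_of_nonneg_left (norm_le_pi_norm (fun j => x j - p) j) (hnn i j)
    _ = _ := by rw [← Finset.sum_mul, hsum, one_mul]

lemma Nonexpansive.norm_relaxation_sub_le {T : H → H} (hT : Nonexpansive T) {p : H}
    (hp : T p = p) {t : ℝ} (ht : 0 ≤ t) (ht1 : t ≤ 1) (y : H) :
    ‖y + t • (T y - y) - p‖ ≤ ‖y - p‖ := by
  refine (pow_le_pow_iff_left₀ (norm_nonneg _) (norm_nonneg _) two_ne_zero).1 ?_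
  have := mul_nonneg (mul_nonneg ht (sub_nonneg.2 ht1)) (sq_nonneg ‖T y - y‖)
  linarith [hT.norm_relaxation_sub_sq_le hp ht y]

variable {F : Fin N → H → H} {G : ℕ → Digraph (Fin N)} {A : ℕ → Matrix (Fin N) (Fin N) ℝ}
  {α : Fin N → ℕ → ℝ} {ε x : Fin N → ℕ → H}

lemma IsIteration.succ_eq (hx : IsIteration F A α ε x) (i : Fin N) (k : ℕ) :
    x i (k + 1) = (aggregate (A k) (fun j => x j k) i + α i k •
      (F i (aggregate (A k) (fun j => x j k) i) - aggregate (A k) (fun j => x j k) i)) +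
        α i k • ε i k := by
  rw [hx i k]
  module

lemma IsIteration.norm_succ_sub_le (hx : IsIteration F A α ε x) (hF : ∀ i, Nonexpansive (F i))
    (hnn : ∀ k i j, 0 ≤ A k i j) (hsum : ∀ k i, ∑ j, A k i j = 1)
    (hα0 : ∀ i k, 0 ≤ α i k) (hα1 : ∀ i k, α i k ≤ 1) {p : H} (hp : ∀ i, F i p = p) (k : ℕ) :
    ‖fun i => x i (k + 1) - p‖ ≤ ‖fun i => x i k - p‖ + ∑ i, ‖ε i k‖ := by
  refine (pi_norm_le_iff_of_nonneg (by positivity)).2 fun i => ?_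
  rw [hx.succ_eq i k, add_sub_right_comm]
  refine norm_add_le_of_le (((hF i).norm_relaxation_sub_le (hp i) (hα0 i k) (hα1 i k) _).trans
    (norm_aggregate_sub_le (hnn k) (hsum k) _ p i)) ?_
  rw [norm_smul, Real.norm_of_nonneg (hα0 i k)]
  calc α i k * ‖ε i k‖ ≤ 1 * ‖ε i k‖ := by gcongr; exact hα1 i k
    _ ≤ ∑ i, ‖ε i k‖ := by
      rw [one_mul]
      exact Finset.single_le_sum (f := fun i => ‖ε i k‖) (fun _ _ => norm_nonneg _)
        (Finset.mem_univ i)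

/-- The decrease of the squared distance of agent `i` to a common fixed point in one step. -/
lemma IsIteration.norm_succ_sub_sq_le (hx : IsIteration F A α ε x)
    (hF : ∀ i, Nonexpansive (F i))
    (hnn : ∀ k i j, 0 ≤ A k i j) (hsum : ∀ k i, ∑ j, A k i j = 1)
    {a : ℝ} (ha : 0 ≤ a) (hα : ∀ i k, α i k ∈ Set.Icc a (1 - a)) {p : H} (hp : ∀ i, F i p = p)
    {B : ℝ} (hB : ∀ k, ‖fun i => x i k - p‖ ≤ B) (i : Fin N) (k : ℕ) :
    ‖x i (k + 1) - p‖ ^ 2 ≤ ∑ j, A k i j * ‖x j k - p‖ ^ 2 -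
      (∑ j, A k i j * ‖x j k - aggregate (A k) (fun j => x j k) i‖ ^ 2 + a ^ 2 *
        ‖F i (aggregate (A k) (fun j => x j k) i) - aggregate (A k) (fun j => x j k) i‖ ^ 2) +
      2 * B * ‖ε i k‖ := by
  obtain ⟨h1, h2⟩ := hα i k
  rw [sum_mul_norm_sub_sq (hsum k i)]
  change _ ≤ ‖aggregate (A k) (fun j => x j k) i - p‖ ^ 2 + ∑ j, A k i j *
    ‖x j k - aggregate (A k) (fun j => x j k) i‖ ^ 2 - _ + _
  have hxk : ‖x i (k + 1) - p‖ ≤ B := (norm_le_pi_norm (fun i => x i (k + 1) - p) i).trans (hB _)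
  have hyB := (norm_aggregate_sub_le (hnn k) (hsum k) (fun j => x j k) p i).trans (hB k)
  have hs := hx.succ_eq i k
  set y := aggregate (A k) (fun j => x j k) i
  set z := y + α i k • (F i y - y)
  have hz : ‖z - p‖ ≤ B :=
    ((hF i).norm_relaxation_sub_le (hp i) (by linarith) (by linarith) y).trans hyB
  have hz2 : ‖z - p‖ ^ 2 ≤ _ := (hF i).norm_relaxation_sub_sq_le (hp i) (by linarith) y
  have hxz : ‖x i (k + 1) - p‖ ≤ ‖z - p‖ + ‖ε i k‖ := by
    rw [hs, add_sub_right_comm]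
    refine norm_add_le_of_le le_rfl ?_
    rw [norm_smul, Real.norm_of_nonneg (by linarith)]
    exact mul_le_of_le_one_left (norm_nonneg _) (by linarith)
  -- Difference of squares: the two distances differ by at most `‖ε i k‖` in the relevant direction
  -- and sum to at most `2 * B`.
  have hd : ‖x i (k + 1) - p‖ ^ 2 ≤ ‖z - p‖ ^ 2 + 2 * B * ‖ε i k‖ := by
    have hB0 : 0 ≤ B := (norm_nonneg _).trans hz
    have h3 := norm_nonneg (x i (k + 1) - p)
    have h4 := norm_nonneg (z - p)
    have h5 := norm_nonneg (ε i k)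
    rcases le_total ‖x i (k + 1) - p‖ ‖z - p‖ with h | h
    · have := pow_le_pow_left₀ h3 h 2
      have : 0 ≤ 2 * B * ‖ε i k‖ := by positivity
      linarith
    · nlinarith
  have ht : a ^ 2 ≤ α i k * (1 - α i k) := by nlinarith
  have := mul_le_mul_of_nonneg_right ht (sq_nonneg ‖F i y - y‖)
  linarith

/-- The disagreements along the edges and the fixed point residuals at the aggregates are
dominated by a square summable sequence. -/
lemma IsIteration.exists_residual_bound (hx : IsIteration F A α ε x) (hN : 0 < N)
    (hF : ∀ i, Nonexpansive (F i))
    {Q : ℕ} (hG : ∀ k, StronglyConnected (⨆ l ∈ Finset.Icc 1 Q, G (k + l)))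
    (hnn : ∀ k i j, 0 ≤ A k i j) (hsum : ∀ k i, ∑ j, A k i j = 1)
    {b : ℝ} (hb : 0 < b) (hlb : ∀ k i j, 0 < A k i j → b ≤ A k i j)
    (hdiag : ∀ k i, 0 < A k i i) (hadj : ∀ k i j, (G k).Adj j i → 0 < A k i j)
    {a : ℝ} (ha : 0 < a) (hα : ∀ i k, α i k ∈ Set.Icc a (1 - a))
    (hε : ∀ i, Summable fun k => ‖ε i k‖) {p : H} (hp : ∀ i, F i p = p) :
    ∃ R : ℕ → ℝ, (∀ k, 0 ≤ R k) ∧ (Summable fun k => R k ^ 2) ∧ ∀ k i,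
      (∀ j, 0 < A k i j → ‖x j k - aggregate (A k) (fun j => x j k) i‖ ≤ R k) ∧
      ‖F i (aggregate (A k) (fun j => x j k) i) - aggregate (A k) (fun j => x j k) i‖ ≤ R k := by
  have hα0 : ∀ i k, 0 ≤ α i k := fun i k => ha.le.trans (hα i k).1
  have hα1 : ∀ i k, α i k ≤ 1 := fun i k => (hα i k).2.trans (by linarith)
  have he0 : ∀ k, 0 ≤ ∑ i, ‖ε i k‖ := fun k => by positivity
  have hes : Summable fun k => ∑ i, ‖ε i k‖ := summable_sum fun i _ => hε i
  have hB := le_add_tsum_of_le_add (M := fun k => ‖fun i => x i k - p‖) he0 hes (hx.norm_succ_sub_le hF hnn hsum hα0 hα1 hp)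
  set B := ‖fun i => x i 0 - p‖ + ∑' k, ∑ i, ‖ε i k‖
  have hB0 : 0 ≤ B := (norm_nonneg _).trans (hB 0)
  have hdec := hx.norm_succ_sub_sq_le hF hnn hsum ha.le hα hp hB
  obtain ⟨g, hg⟩ : ∃ g : Fin N → ℕ → ℝ, ∀ i k, g i k =
      ∑ j, A k i j * ‖x j k - aggregate (A k) (fun j => x j k) i‖ ^ 2 + a ^ 2 *
        ‖F i (aggregate (A k) (fun j => x j k) i) - aggregate (A k) (fun j => x j k) i‖ ^ 2 :=
    ⟨_, fun _ _ => rfl⟩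
  simp_rw [← hg] at hdec
  have hterm : ∀ i k j, 0 ≤ A k i j * ‖x j k - aggregate (A k) (fun j => x j k) i‖ ^ 2 :=
    fun i k j => mul_nonneg (hnn _ _ _) (sq_nonneg _)
  have hg0 : ∀ i k, 0 ≤ g i k := fun i k => by
    rw [hg]
    exact add_nonneg (Finset.sum_nonneg fun j _ => hterm i k j) (by positivity)
  have hgsum : Summable fun k => ∑ i, g i k := by
    set η := b ^ (N * Q) / N with hη
    have hη0 : 0 < η := by positivity
    refine summable_of_sum_range_le (c := (B ^ 2 + 2 * B * ∑' k, ∑ i, ‖ε i k‖) / η)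
      (fun k => Finset.sum_nonneg fun i _ => hg0 i k) fun n => ?_
    -- The horizon leaves `N * Q` steps beyond every time used, so `η` bounds the weights below; the
    -- weights depend on `n`, but `η` does not.
    obtain ⟨w, hw0, hw1, hw⟩ := exists_backward_weights hN (n + 1 + N * Q) A hnn hsum
    have hlow : ∀ k < n, ∀ j, η ≤ w (k + 1) j := fun k hk j =>
      backward_weights_lower_bound hG hnn hb (fun k i => hlb _ _ _ (hdiag k i))
        (fun k i j h => hlb _ _ _ (hadj k i j h)) hw0 hw1 hw (by omega) j
    have hw_le : ∀ k i, w k i ≤ 1 := fun k i => by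
      rw [← hw1 k]
      exact Finset.single_le_sum (fun i _ => hw0 k i) (Finset.mem_univ i)
    have hstep : ∀ k < n, ∑ i, w (k + 1) i * ‖x i (k + 1) - p‖ ^ 2 ≤
        ∑ i, w k i * ‖x i k - p‖ ^ 2 - η * ∑ i, g i k + 2 * B * ∑ i, ‖ε i k‖ := by
      intro k hk
      calc ∑ i, w (k + 1) i * ‖x i (k + 1) - p‖ ^ 2
          ≤ ∑ i, (w (k + 1) i * (∑ j, A k i j * ‖x j k - p‖ ^ 2) - η * g i k +
              2 * B * ‖ε i k‖) := by
            refine Finset.sum_le_sum fun i _ => ?_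
            have h1 := mul_le_mul_of_nonneg_left (hdec i k) (hw0 (k + 1) i)
            have h2 := mul_le_mul_of_nonneg_right (hlow k hk i) (hg0 i k)
            have h3 := mul_le_mul_of_nonneg_right (hw_le (k + 1) i)
              (show 0 ≤ 2 * B * ‖ε i k‖ by positivity)
            linarith
        _ = _ := by
            rw [Finset.sum_add_distrib, Finset.sum_sub_distrib, ← Finset.mul_sum,
              ← Finset.mul_sum]
            congr 2
            simp_rw [hw k (by omega), Finset.mul_sum, Finset.sum_mul]
            rw [Finset.sum_comm]
            simp_rw [mul_assoc]
    have hpart : ∀ m ≤ n, η * ∑ k ∈ Finset.range m, ∑ i, g i k +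
        ∑ i, w m i * ‖x i m - p‖ ^ 2 ≤
          ∑ i, w 0 i * ‖x i 0 - p‖ ^ 2 + 2 * B * ∑ k ∈ Finset.range m, ∑ i, ‖ε i k‖ := by
      intro m
      induction m with
      | zero => simp
      | succ m ih =>
        intro hm
        rw [Finset.sum_range_succ, Finset.sum_range_succ, mul_add, mul_add]
        linarith [ih (by omega), hstep m (by omega)]
    have h0 : ∑ i, w 0 i * ‖x i 0 - p‖ ^ 2 ≤ B ^ 2 := by
      calc ∑ i, w 0 i * ‖x i 0 - p‖ ^ 2 ≤ ∑ i, w 0 i * B ^ 2 := by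
            refine Finset.sum_le_sum fun i _ => mul_le_mul_of_nonneg_left ?_ (hw0 _ _)
            have := (norm_le_pi_norm (fun i => x i 0 - p) i).trans (hB 0)
            gcongr
        _ = B ^ 2 := by rw [← Finset.sum_mul, hw1, one_mul]
    have hn0 : 0 ≤ ∑ i, w n i * ‖x i n - p‖ ^ 2 :=
      Finset.sum_nonneg fun i _ => mul_nonneg (hw0 _ _) (sq_nonneg _)
    have htail := mul_le_mul_of_nonneg_left
      (hes.sum_le_tsum (Finset.range n) fun k _ => he0 k) (show 0 ≤ 2 * B by positivity)
    rw [le_div_iff₀ hη0]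
    linarith [hpart n le_rfl]
  -- Both kinds of loss enter `g` with coefficient at least `c`: an edge weight is at least `b`, and
  -- the residual carries `a ^ 2`.
  set c := min b (a ^ 2) with hc
  have hc0 : 0 < c := lt_min hb (by positivity)
  have hS0 : ∀ k, 0 ≤ ∑ i, g i k := fun k => Finset.sum_nonneg fun i _ => hg0 i k
  have hle : ∀ k i, ∀ r : ℝ, c * r ^ 2 ≤ g i k → r ≤ √((∑ i, g i k) / c) := by
    intro k i r hr
    refine Real.le_sqrt_of_sq_le ?_
    rw [le_div_iff₀ hc0, mul_comm]
    exact hr.trans (Finset.single_le_sum (f := fun i => g i k) (fun i _ => hg0 i k)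
      (Finset.mem_univ i))
  refine ⟨fun k => √((∑ i, g i k) / c), fun k => Real.sqrt_nonneg _, ?_, fun k i => ⟨?_, ?_⟩⟩
  · simp_rw [Real.sq_sqrt (div_nonneg (hS0 _) hc0.le)]
    exact hgsum.div_const c
  · intro j hj
    refine hle k i _ ?_
    rw [hg]
    have h1 := Finset.single_le_sum (fun j _ => hterm i k j) (Finset.mem_univ j)
    have h2 := mul_le_mul_of_nonneg_right ((min_le_left _ _).trans (hlb k i j hj) : c ≤ A k i j)
      (sq_nonneg ‖x j k - aggregate (A k) (fun j => x j k) i‖)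
    have h3 : 0 ≤ a ^ 2 * ‖F i (aggregate (A k) (fun j => x j k) i) -
      aggregate (A k) (fun j => x j k) i‖ ^ 2 := by positivity
    linarith
  · refine hle k i _ ?_
    rw [hg]
    have h1 := Finset.sum_nonneg fun j (_ : j ∈ Finset.univ) => hterm i k j
    have h2 := mul_le_mul_of_nonneg_right (min_le_right _ _ : c ≤ a ^ 2)
      (sq_nonneg ‖F i (aggregate (A k) (fun j => x j k) i) -
        aggregate (A k) (fun j => x j k) i‖)
    linarith

/-- If the disagreements along the edges and the increments are dominated by a square summable
sequence, then so are the disagreements between all agents. -/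
lemma exists_disagreement_bound {E : Type*} [SeminormedAddCommGroup E] {x : Fin N → ℕ → E}
    {Q : ℕ}
    (hG : ∀ k, StronglyConnected (⨆ l ∈ Finset.Icc 1 Q, G (k + l)))
    {D : ℕ → ℝ} (hD0 : ∀ k, 0 ≤ D k) (hD : Summable fun k => D k ^ 2)
    (hstep : ∀ k i, ‖x i (k + 1) - x i k‖ ≤ D k)
    (hedge : ∀ k i j, (G k).Adj j i → ‖x i k - x j k‖ ≤ D k) :
    ∃ d : ℕ → ℝ, (Summable fun k => d k ^ 2) ∧ ∀ k i j, ‖x i k - x j k‖ ≤ d k := by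
  -- An edge active at time `k + l` is compared with time `k` by moving each endpoint and crossing
  -- once, hence `3`; `N` bounds the number of edges in a chain.
  refine ⟨fun k => N * (3 * ∑ l ∈ Finset.range (Q + 1), D (k + l)),
    summable_sq_const_mul _ (summable_sq_const_mul _ (summable_sq_sum_range_shift hD _)), ?_⟩
  intro k
  have hmove : ∀ l i, ‖x i (k + l) - x i k‖ ≤ ∑ l ∈ Finset.range l, D (k + l) := by
    intro l i
    induction l with
    | zero => simp
    | succ l ih =>
      rw [Finset.sum_range_succ, ← add_assoc]
      have := norm_sub_le_norm_sub_add_norm_sub (x i (k + l + 1)) (x i (k + l)) (x i k)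
      linarith [hstep (k + l) i]
  refine norm_sub_le_of_stronglyConnected (hG k)
    (mul_nonneg zero_le_three (Finset.sum_nonneg fun l _ => hD0 _)) fun u v huv => ?_
  simp only [Digraph.iSup_adj, Finset.mem_Icc, exists_prop] at huv
  obtain ⟨l, ⟨-, hl⟩, huv⟩ := huv
  have hsub : ∑ l ∈ Finset.range l, D (k + l) ≤ ∑ l ∈ Finset.range (Q + 1), D (k + l) :=
    Finset.sum_le_sum_of_subset_of_nonneg (Finset.range_mono (by omega)) fun _ _ _ => hD0 _
  have hone : D (k + l) ≤ ∑ l ∈ Finset.range (Q + 1), D (k + l) :=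
    Finset.single_le_sum (f := fun l => D (k + l)) (fun _ _ => hD0 _)
      (Finset.mem_range.2 (by omega))
  have h1 := norm_sub_le_norm_sub_add_norm_sub (x v k) (x v (k + l)) (x u k)
  have h2 := norm_sub_le_norm_sub_add_norm_sub (x v (k + l)) (x u (k + l)) (x u k)
  rw [norm_sub_rev (x v k) (x v (k + l))] at h1
  linarith [hmove l u, hmove l v, hedge _ _ _ huv]

end Iteration

end DIKM

/-! ### Weak convergence and the rate -/

theorem theorem1 {H : Type*} [NormedAddCommGroup H] [InnerProductSpace ℝ H] [CompleteSpace H]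
    (N : ℕ) (hN : 0 < N)
    (F : Fin N → H → H) (hF : ∀ i, DIKM.Nonexpansive (F i))
    (hX : (DIKM.commonFixedPoints F).Nonempty)
    (G : ℕ → Digraph (Fin N)) (A : ℕ → Matrix (Fin N) (Fin N) ℝ)
    (hGA : ∀ k, DIKM.IsWeightMatrix (G k) (A k))
    (hA : DIKM.ConnectivityAndWeightsRule G A)
    (α : Fin N → ℕ → ℝ)
    (hα : ∃ a : ℝ, 0 < a ∧ a ≤ 1 / 2 ∧ ∀ i k, α i k ∈ Set.Icc a (1 - a))
    (ε : Fin N → ℕ → H) (hε : ∀ i, Summable (fun k => ‖ε i k‖))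
    (x : Fin N → ℕ → H) (hx : DIKM.IsIteration F A α ε x) :
    ((∃ C : ℝ, ∀ i k, ‖x i k‖ ≤ C) ∧
      ∃ p ∈ DIKM.commonFixedPoints F, ∀ i,
        Tendsto (fun k => toWeakSpace ℝ H (x i k)) atTop (𝓝 (toWeakSpace ℝ H p))) ∧
    ∃ φ : ℕ → ℕ, StrictMono φ ∧ ∀ i,
      (fun l => ‖F i (x i (φ l)) - x i (φ l)‖) =O[atTop] fun l => 1 / √(φ l : ℝ) := by
  obtain ⟨⟨Q, -, hG⟩, hsum, b, hb, -, hlb⟩ := hA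
  obtain ⟨a, ha, -, hα⟩ := hα
  obtain ⟨p₀, hp₀⟩ := hX
  have hfix : ∀ p, p ∈ DIKM.commonFixedPoints F ↔ ∀ i, F i p = p := fun p => Set.mem_iInter
  have hnn : ∀ k i j, 0 ≤ A k i j := fun k i j => by
    by_cases h : (G k).Adj j i
    · exact ((hGA k).pos_of_edge i j h).le
    · exact ((hGA k).zero_of_not_edge i j h).ge
  have hα0 : ∀ i k, 0 ≤ α i k := fun i k => ha.le.trans (hα i k).1
  have hα1 : ∀ i k, α i k ≤ 1 := fun i k => (hα i k).2.trans (by linarith)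
  have he0 : ∀ k, 0 ≤ ∑ i, ‖ε i k‖ := fun k => by positivity
  have hes : Summable fun k => ∑ i, ‖ε i k‖ := summable_sum fun i _ => hε i
  obtain ⟨R, hR0, hR, hRb⟩ := hx.exists_residual_bound hN hF hG hnn hsum hb
    (fun k i j h => (hlb k i j h).le) (fun k => (hGA k).diag_pos)
    (fun k => (hGA k).pos_of_edge) ha hα hε ((hfix p₀).1 hp₀)
  have hxy := fun k i => (hRb k i).1
  have hFy := fun k i => (hRb k i).2
  obtain ⟨d, hd, hxx⟩ : ∃ d : ℕ → ℝ, (Summable fun k => d k ^ 2) ∧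
      ∀ k i j, ‖x i k - x j k‖ ≤ d k := by
    -- An increment consists of averaging, relaxation and error; an edge is crossed in two hops
    -- through the aggregate.
    refine DIKM.exists_disagreement_bound hG (D := fun k => 2 * R k + ∑ i, ‖ε i k‖)
      (fun k => add_nonneg (mul_nonneg zero_le_two (hR0 k)) (he0 k))
      (DIKM.summable_sq_add (DIKM.summable_sq_const_mul 2 hR)
        (DIKM.summable_sq_of_summable he0 hes)) (fun k i => ?_) fun k i j hij => ?_
    · rw [hx.succ_eq i k]
      have h1 := hxy k i i ((hGA k).diag_pos i)
      have h2 := hFy k i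
      set y := DIKM.aggregate (A k) (fun j => x j k) i
      have h3 : ‖α i k • (F i y - y)‖ ≤ R k := by
        rw [norm_smul, Real.norm_of_nonneg (hα0 i k)]
        exact (mul_le_of_le_one_left (norm_nonneg _) (hα1 i k)).trans h2
      have h4 : ‖α i k • ε i k‖ ≤ ∑ i, ‖ε i k‖ := by
        rw [norm_smul, Real.norm_of_nonneg (hα0 i k)]
        exact (mul_le_of_le_one_left (norm_nonneg _) (hα1 i k)).trans
          (Finset.single_le_sum (f := fun i => ‖ε i k‖) (fun _ _ => norm_nonneg _)
            (Finset.mem_univ i))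
      rw [norm_sub_rev] at h1
      rw [show y + α i k • (F i y - y) + α i k • ε i k - x i k =
        (y - x i k) + α i k • (F i y - y) + α i k • ε i k by abel, two_mul]
      exact norm_add_le_of_le (norm_add_le_of_le h1 h3) h4
    · have h1 := hxy k i i ((hGA k).diag_pos i)
      have h2 := hxy k i j ((hGA k).pos_of_edge i j hij)
      have h3 := norm_sub_le_norm_sub_add_norm_sub (x i k)
        (DIKM.aggregate (A k) (fun j => x j k) i) (x j k)
      rw [norm_sub_rev (DIKM.aggregate _ _ _) (x j k)] at h3
      linarith [he0 k]
  -- Passing from the aggregate to `x i k` costs `R k` twice: once inside `F i` and once outside.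
  have hres : ∀ k i, ‖F i (x i k) - x i k‖ ≤ 3 * R k := by
    intro k i
    have h1 := hxy k i i ((hGA k).diag_pos i)
    have h2 := hFy k i
    set y := DIKM.aggregate (A k) (fun j => x j k) i
    have h3 := norm_sub_le_norm_sub_add_norm_sub (F i (x i k)) (F i y) (x i k)
    have h4 := norm_sub_le_norm_sub_add_norm_sub (F i y) y (x i k)
    rw [norm_sub_rev y] at h4
    linarith [hF i (x i k) y]
  have hR3 := DIKM.summable_sq_const_mul 3 hR
  have hd0 := DIKM.tendsto_zero_of_summable_sq hd
  have hbdd : ∃ C : ℝ, ∀ i k, ‖x i k‖ ≤ C := by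
    refine ⟨‖fun i => x i 0 - p₀‖ + ∑' k, ∑ i, ‖ε i k‖ + ‖p₀‖, fun i k => ?_⟩
    have h1 := DIKM.le_add_tsum_of_le_add (M := fun k => ‖fun i => x i k - p₀‖) he0 hes
      (hx.norm_succ_sub_le hF hnn hsum hα0 hα1 ((hfix p₀).1 hp₀)) k
    have h2 : ‖x i k - p₀‖ ≤ _ := norm_le_pi_norm (fun i => x i k - p₀) i
    have h3 := norm_sub_norm_le (x i k) p₀
    linarith
  refine ⟨⟨hbdd, ?_⟩, ?_⟩
  · obtain ⟨C, hC⟩ := hbdd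
    suffices h : ∃ p ∈ DIKM.commonFixedPoints F, ∀ v,
        Tendsto (fun k => inner ℝ (x ⟨0, hN⟩ k) v) atTop (𝓝 (inner ℝ p v)) by
      obtain ⟨p, hp, hweak⟩ := h
      refine ⟨p, hp, fun i => DIKM.tendsto_toWeakSpace_of_tendsto_inner fun v => ?_⟩
      exact DIKM.tendsto_inner_of_norm_sub_le hd0 (fun k => hxx k i ⟨0, hN⟩) (hweak v)
    refine DIKM.exists_weak_limit_of_opial (hC ⟨0, hN⟩) (fun p hp => ?_) fun U w hU hw => ?_
    · obtain ⟨l, hl⟩ := DIKM.exists_tendsto_of_le_add_summable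
        (M := fun k => ‖fun i => x i k - p‖) (fun k => norm_nonneg _) he0 hes
        (hx.norm_succ_sub_le hF hnn hsum hα0 hα1 ((hfix p).1 hp))
      -- A single agent's distance to `p` lies between the maximum minus `d k` and the maximum, so
      -- it inherits the limit.
      refine ⟨l, tendsto_of_tendsto_of_tendsto_of_le_of_le
        (by simpa using hl.sub hd0) hl (fun k => ?_) fun k => ?_⟩
      · have : ‖fun i => x i k - p‖ ≤ ‖x ⟨0, hN⟩ k - p‖ + d k := by
          refine (pi_norm_le_iff_of_nonneg (add_nonneg (norm_nonneg _)
            ((norm_nonneg _).trans (hxx k ⟨0, hN⟩ ⟨0, hN⟩)))).2 fun i => ?_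
          have := norm_sub_le_norm_sub_add_norm_sub (x i k) (x ⟨0, hN⟩ k) p
          linarith [hxx k i ⟨0, hN⟩]
        simpa using this
      · exact norm_le_pi_norm (fun i => x i k - p) ⟨0, hN⟩
    · refine (hfix w).2 fun i => (hF i).isFixedPt_of_tendsto (hC i) (l := U) (fun v => ?_) ?_
      · exact DIKM.tendsto_inner_of_norm_sub_le (hd0.mono_left hU) (fun k => hxx k i ⟨0, hN⟩)
          (hw v)
      · exact (squeeze_zero (fun k => norm_nonneg _) (fun k => hres k i)
          (DIKM.tendsto_zero_of_summable_sq hR3)).mono_left hU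
  · obtain ⟨φ, hφ, hle⟩ := DIKM.exists_strictMono_le_one_div_sqrt hR3
    refine ⟨φ, hφ, fun i => IsBigO.of_bound 1 (Eventually.of_forall fun l => ?_)⟩
    rw [norm_norm, one_mul, Real.norm_of_nonneg (by positivity)]
    exact (hres _ i).trans (hle l)
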